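/- Let $\Gamma$ be a countable discrete group with identity $e$, and let $\sigma : \Gamma\times\Gamma\to\mathbb{T}$ be a cocycle, i.e. $\sigma(x,yz)\sigma(y,z)=\sigma(xy,z)\sigma(x,y)$ and $\sigma(x,e)=\sigma(e,x)=1$ for all $x,y,z\in\Gamma$. Let $\pi$ be a $\sigma$-representation of $\Gamma$ on a nonzero separable complex Hilbert space $\mathcal{H}_\pi$, i.e. a map from $\Gamma$ to the unitary operators on $\mathcal{H}_\pi$ with $\pi(e)=I$ and $\pi(x)\pi(y)=\sigma(x,y)\pi(xy)$ for all $x,y\in\Gamma$. Assume that $\pi$ is square-integrable: there is a norm dense linear subspace $\mathcal{D}\subseteq\mathcal{H}_\pi$ such that $(\langle f,\pi(\gamma)g\rangle)_{\gamma\in\Gamma}\in\ell^2(\Gamma)$ for all $f\in\mathcal{H}_\pi$ and $g\in\mathcal{D}$. Assume that $(\Gamma,\sigma)$ satisfies Kleppner's condition: whenever $\gamma_0\in\Gamma\setminus\{e\}$ satisfies $\sigma(\gamma_0,\gamma)=\sigma(\gamma,\gamma_0)$ for all $\gamma\in\Gamma$ commuting with $\gamma_0$, the conjugacy class $\{\gamma\gamma_0\gamma^{-1}:\gamma\in\Gamma\}$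 is infinite. Let $\mathcal{B}_\pi$ be the space of Bessel vectors, i.e. of those $g\in\mathcal{H}_\pi$ for which there is $B>0$ with $\sum_{\gamma\in\Gamma}|\langle f,\pi(\gamma)g\rangle|^2\le B\|f\|^2$ for all $f\in\mathcal{H}_\pi$, and let $\pi(\Gamma)''$ be the double commutant of $\{\pi(\gamma):\gamma\in\Gamma\}$ in the algebra of bounded linear operators on $\mathcal{H}_\pi$. Then, for every operator $T\in\pi(\Gamma)''$, there exists a unique $c=(c_\gamma)_{\gamma\in\Gamma}\in\ell^2(\Gamma)$ such that $$T f=\sum_{\gamma\in\Gamma}c_\gamma\,\pi(\gamma)f\qquad\text{for all } f\in\mathcal{B}_\pi,$$ where the series converges unconditionally in the norm of $\mathcal{H}_\pi$. -/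

import Mathlib

/-- A cocycle (multiplier) on a discrete group. Measurability is automatic for discrete groups. -/
structure Cocycle (Γ : Type*) [Group Γ] where
  toFun : Γ → Γ → Circle
  cocycle : ∀ x y z : Γ, toFun x (y * z) * toFun y z = toFun (x * y) z * toFun x y
  right_one : ∀ x : Γ, toFun x 1 = 1
  left_one : ∀ x : Γ, toFun 1 x = 1

/-- A `σ`-representation of a discrete group: a projective unitary representation with
cocycle `σ`. Weak measurability is automatic for discrete groups. -/
structure SigmaRep {Γ : Type*} [Group Γ] (σ : Cocycle Γ) (H : Type*)
    [NormedAddCommGroup H] [InnerProductSpace ℂ H] [CompleteSpace H] where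
  toFun : Γ → unitary (H →L[ℂ] H)
  map_mul : ∀ x y : Γ, (toFun x : H →L[ℂ] H) * (toFun y : H →L[ℂ] H)
    = (σ.toFun x y : ℂ) • (toFun (x * y) : H →L[ℂ] H)
  map_one : toFun 1 = 1

namespace Cocycle

variable {Γ : Type*} [Group Γ]

/-- `γ₀` is `σ`-regular. -/
def IsRegular (σ : Cocycle Γ) (γ₀ : Γ) : Prop :=
  ∀ γ : Γ, γ * γ₀ = γ₀ * γ → σ.toFun γ₀ γ = σ.toFun γ γ₀

/-- Kleppner's condition for `(Γ, σ)`: nontrivial `σ`-regular elements have infinite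
conjugacy classes. -/
def Kleppner (σ : Cocycle Γ) : Prop :=
  ∀ γ₀ : Γ, γ₀ ≠ 1 → σ.IsRegular γ₀ → (Set.range fun γ : Γ => γ * γ₀ * γ⁻¹).Infinite

end Cocycle

namespace SigmaRep

variable {Γ : Type*} [Group Γ] {σ : Cocycle Γ} {H : Type*}
  [NormedAddCommGroup H] [InnerProductSpace ℂ H] [CompleteSpace H]

/-- The bounded operator `π(γ)` on `H`. -/
def op (π : SigmaRep σ H) (γ : Γ) : H →L[ℂ] H := (π.toFun γ : H →L[ℂ] H)

/-- The matrix coefficient `C_g f (γ) = ⟨f, π(γ) g⟩`, linear in `f`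
(the inner product of Mathlib is linear in its second argument). -/
noncomputable def coeff (π : SigmaRep σ H) (g f : H) (γ : Γ) : ℂ :=
  InnerProductSpace.toInner.inner (𝕜 := ℂ) (π.op γ g) f

/-- Square-integrability: for all `g` in some norm dense subspace and all `f`, the matrix
coefficient `C_g f` belongs to `ℓ²(Γ)`. -/
def IsSquareIntegrable (π : SigmaRep σ H) : Prop :=
  ∃ D : Submodule ℂ H, Dense (D : Set H) ∧
    ∀ f : H, ∀ g ∈ D, Memℓp (π.coeff g f) 2

/-- The set of Bessel vectors of `π`. -/
def besselVectors (π : SigmaRep σ H) : Set H :=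
  {g | ∃ B : ℝ, 0 < B ∧ ∀ f : H,
    Summable (fun γ : Γ => ‖π.coeff g f γ‖ ^ 2) ∧
    ∑' γ : Γ, ‖π.coeff g f γ‖ ^ 2 ≤ B * ‖f‖ ^ 2}

/-- The double commutant `π(Γ)''` in the bounded operators on `H`. -/
def vonNeumann (π : SigmaRep σ H) : Set (H →L[ℂ] H) :=
  Set.centralizer (Set.centralizer (Set.range π.op))

end SigmaRep

/-! For a Bessel vector `f`, let C_f : H → ℓ² be the analysis operator; its adjoint is synthesis c ↦
∑ c_γ π(γ)f.

Existence: c must satisfy ⟨c, C_f h⟩ = ⟨Tf, h⟩ = (C_f T*h)(e) for all f, h. By Riesz it suffices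
that ∑ C_{f_i} h_i ↦ ∑ C_{f_i} T*h_i is bounded. Each C_f* C_g lies in π(Γ)', so it commutes with
T*; hence the row V = (C_{f_i}) has V*V commuting with the diagonal operator T*, and |V| gives the
bound ‖T*‖ (`exists_synthesis_eq`).

Uniqueness: let N be the joint kernel of all synthesis maps, and p the projection of δ_e to N.
Twisted conjugations preserve N and fix δ_e, hence fix p. Kleppner's condition and
square-summability then leave p supported at e, and synthesis on one nonzero vector kills p(e). So
δ_e ⟂ N, and twisted translations give N = 0 (`synthesisKer_eq_bot`). -/

open scoped InnerProductSpace ComplexConjugate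

/-! ### Twisted permutations of ℓ² -/

section LpTwist

variable {Γ : Type*}

/-- Weighted reindexing of `ℓ²` by a permutation `e` and a unimodular weight `u`. -/
noncomputable def lpTwist (e : Γ ≃ Γ) (u : Γ → Circle) :
    lp (fun _ : Γ => ℂ) 2 →ₗᵢ[ℂ] lp (fun _ : Γ => ℂ) 2 where
  toFun c := ⟨fun γ => (u γ : ℂ) * c (e γ), by
    have h := (memℓp_gen_iff (p := 2) (by norm_num)).1 (lp.memℓp c)
    refine (memℓp_gen_iff (p := 2) (by norm_num)).2 ?_
    refine (e.summable_iff.2 h).congr fun γ => ?_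
    exact congrArg (· ^ (2 : ENNReal).toReal)
      ((norm_mul (u γ : ℂ) (c (e γ))).trans (by rw [Circle.norm_coe, one_mul])).symm⟩
  map_add' c d := by
    ext γ
    exact mul_add (u γ : ℂ) (c (e γ)) (d (e γ))
  map_smul' a c := by
    ext γ
    exact mul_left_comm (u γ : ℂ) a (c (e γ))
  norm_map' c := by
    have h2 : (0 : ℝ) < (2 : ENNReal).toReal := by norm_num
    rw [lp.norm_eq_tsum_rpow h2, lp.norm_eq_tsum_rpow h2]
    congr 1
    rw [← e.tsum_eq fun γ => ‖c γ‖ ^ (2 : ENNReal).toReal]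
    refine tsum_congr fun γ => congrArg (· ^ (2 : ENNReal).toReal) ?_
    exact (norm_mul (u γ : ℂ) (c (e γ))).trans (by rw [Circle.norm_coe, one_mul])

@[simp]
theorem lpTwist_apply (e : Γ ≃ Γ) (u : Γ → Circle) (c : lp (fun _ : Γ => ℂ) 2) (γ : Γ) :
    lpTwist e u c γ = (u γ : ℂ) * c (e γ) := rfl

theorem lp_two_finite_norm_ge (c : lp (fun _ : Γ => ℂ) 2) {r : ℝ} (hr : 0 < r) :
    {γ | r ≤ ‖c γ‖}.Finite := by
  have h := ((memℓp_gen_iff (p := 2) (by norm_num)).1 (lp.memℓp c)).tendsto_cofinite_zero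
  have h1 := h.eventually_lt_const (show (0 : ℝ) < r ^ (2 : ENNReal).toReal by positivity)
  refine (Filter.eventually_cofinite.1 h1).subset fun γ hγ => ?_
  simp only [Set.mem_ofPred_eq, not_lt] at hγ ⊢
  exact Real.rpow_le_rpow hr.le hγ (by norm_num)

end LpTwist

/-! ### Hilbert space lemmas: projections, commutation bounds, Riesz -/

section HilbertSpace

/-- A linear isometry that fixes `d` and preserves `N` fixes the projection of `d` to `N`. -/
theorem starProjection_eq_of_isometry {F : Type*} [NormedAddCommGroup F] [InnerProductSpace ℂ F]
    (N : Submodule ℂ F) [N.HasOrthogonalProjection] (V : F →ₗᵢ[ℂ] F)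
    (hV : ∀ c ∈ N, V c ∈ N) {d : F} (hd : V d = d) :
    V (N.starProjection d) = N.starProjection d := by
  set p := N.starProjection d with hp
  have hpN : p ∈ N := N.starProjection_apply_mem d
  -- `V p` is a point of `N` as close to `d` as `p` is, so Pythagoras forces `V p = p`.
  have h1 : ‖d - V p‖ = ‖d - p‖ := by
    rw [← V.norm_map (d - p), map_sub, hd]
  have h2 : ⟪d - p, p - V p⟫_ℂ = 0 :=
    N.starProjection_inner_eq_zero d _ (N.sub_mem hpN (hV p hpN))
  have h3 := norm_add_sq_eq_norm_sq_add_norm_sq_of_inner_eq_zero (𝕜 := ℂ) _ _ h2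
  rw [sub_add_sub_cancel, h1] at h3
  have h4 : ‖p - V p‖ = 0 := by nlinarith [norm_nonneg (p - V p)]
  exact (sub_eq_zero.1 (norm_eq_zero.1 h4)).symm

variable {E F : Type*} [NormedAddCommGroup E] [InnerProductSpace ℂ E] [CompleteSpace E]
  [NormedAddCommGroup F] [InnerProductSpace ℂ F] [CompleteSpace F]

open ContinuousLinearMap in
/-- If `S` commutes with `V* V`, then `V (x) ↦ V (S x)` is bounded by `‖S‖`. -/
theorem norm_apply_comp_le_of_commute (V : E →L[ℂ] F) (S : E →L[ℂ] E)
    (h : Commute (adjoint V ∘L V) S) (x : E) : ‖V (S x)‖ ≤ ‖S‖ * ‖V x‖ := by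
  set A : E →L[ℂ] E := adjoint V ∘L V with hA
  have hpos : 0 ≤ A := by
    rw [nonneg_iff_isPositive]
    exact isPositive_adjoint_comp_self V
  have hQ : 0 ≤ CFC.sqrt A := CFC.sqrt_nonneg A
  have hQQ : CFC.sqrt A * CFC.sqrt A = A := CFC.sqrt_mul_sqrt_self A hpos
  have hcomm : Commute (CFC.sqrt A) S := by
    rw [CFC.sqrt]
    exact Commute.cfcₙ_nnreal h _
  have hsa : adjoint (CFC.sqrt A) = CFC.sqrt A := (IsSelfAdjoint.of_nonneg hQ)
  have hnorm : ∀ y, ‖V y‖ = ‖CFC.sqrt A y‖ := fun y => by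
    have h1 : ⟪V y, V y⟫_ℂ = ⟪CFC.sqrt A y, CFC.sqrt A y⟫_ℂ := by
      rw [← adjoint_inner_left V, ← adjoint_inner_left (CFC.sqrt A), hsa]
      change ⟪A y, y⟫_ℂ = ⟪(CFC.sqrt A * CFC.sqrt A) y, y⟫_ℂ
      rw [hQQ]
    rw [inner_self_eq_norm_sq_to_K, inner_self_eq_norm_sq_to_K] at h1
    have h2 : ‖V y‖ ^ 2 = ‖CFC.sqrt A y‖ ^ 2 := by exact_mod_cast h1
    exact (sq_eq_sq₀ (norm_nonneg _) (norm_nonneg _)).1 h2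
  have h3 : CFC.sqrt A (S x) = S (CFC.sqrt A x) := congrArg (fun B : E →L[ℂ] E => B x) hcomm.eq
  rw [hnorm, hnorm, h3]
  exact S.le_opNorm _

/-- Riesz representation of a functional dominated by a linear map into a Hilbert space. -/
theorem exists_inner_eq_of_norm_le {M : Type*} [AddCommGroup M] [Module ℂ M]
    (A : M →ₗ[ℂ] F) (φ : M →ₗ[ℂ] ℂ) (K : ℝ) (h : ∀ m, ‖φ m‖ ≤ K * ‖A m‖) :
    ∃ c : F, ∀ m, ⟪c, A m⟫_ℂ = φ m := by
  obtain ⟨s, hs⟩ := A.rangeRestrict.exists_rightInverse_of_surjective A.range_rangeRestrict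
  have hs' : ∀ y : LinearMap.range A, A (s y) = y := fun y =>
    congrArg Subtype.val (LinearMap.congr_fun hs y)
  let ψ : LinearMap.range A →L[ℂ] ℂ := (φ ∘ₗ s).mkContinuous K fun y => by
    simpa [hs' y] using h (s y)
  obtain ⟨Ψ, hΨ, -⟩ := exists_extension_norm_eq (LinearMap.range A) ψ
  refine ⟨(InnerProductSpace.toDual ℂ F).symm Ψ, fun m => ?_⟩
  rw [InnerProductSpace.toDual_symm_apply]
  have h1 := hΨ ⟨A m, m, rfl⟩
  rw [h1]
  change φ (s ⟨A m, m, rfl⟩) = φ m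
  -- The bound makes `φ` vanish on the kernel of `A`, so the choice of section `s` is immaterial.
  rw [← sub_eq_zero, ← map_sub, ← norm_le_zero_iff]
  simpa [hs'] using h (s ⟨A m, m, rfl⟩ - m)

variable {ι : Type*} [Fintype ι]

/-- The diagonal amplification of an operator to a finite Hilbert sum. -/
noncomputable def amplification (ι : Type*) [Fintype ι] (R : E →L[ℂ] E) :
    PiLp 2 (fun _ : ι => E) →L[ℂ] PiLp 2 (fun _ : ι => E) :=
  LinearMap.mkContinuous
    { toFun := fun x => WithLp.toLp 2 fun i => R (x i)
      map_add' := fun x y => by ext i; simp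
      map_smul' := fun a x => by ext i; simp } ‖R‖ fun x => by
    refine (sq_le_sq₀ (norm_nonneg _) (by positivity)).1 ?_
    rw [mul_pow, PiLp.norm_sq_eq_of_L2, PiLp.norm_sq_eq_of_L2, Finset.mul_sum]
    refine Finset.sum_le_sum fun i _ => ?_
    rw [← mul_pow]
    exact pow_le_pow_left₀ (norm_nonneg _) (R.le_opNorm _) 2

omit [CompleteSpace E] in
@[simp]
theorem amplification_apply (R : E →L[ℂ] E) (x : PiLp 2 (fun _ : ι => E)) (i : ι) :
    amplification ι R x i = R (x i) := rfl

omit [CompleteSpace E] in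
theorem norm_amplification_le (R : E →L[ℂ] E) : ‖amplification ι R‖ ≤ ‖R‖ :=
  LinearMap.mkContinuous_norm_le _ (norm_nonneg _) _

-- The single-operator bound applied to the row operator `V = (C i)`: the entries of V*V are (C i)*
-- (C j), so V*V commutes with the amplification of `R`. The constant does not depend on the number
-- of terms.
open ContinuousLinearMap in
theorem norm_sum_apply_comp_le_of_commute (C : ι → E →L[ℂ] F) (R : E →L[ℂ] E)
    (h : ∀ i j, Commute (adjoint (C i) ∘L C j) R) (x : ι → E) :
    ‖∑ i, C i (R (x i))‖ ≤ ‖R‖ * ‖∑ i, C i (x i)‖ := by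
  classical
  let V : PiLp 2 (fun _ : ι => E) →L[ℂ] F := ∑ i, C i ∘L PiLp.proj 2 (fun _ : ι => E) i
  have hV : ∀ y, V y = ∑ i, C i (y i) := fun y => by simp [V]
  have hV' : ∀ y i, adjoint V y i = adjoint (C i) y := fun y i => by
    refine ext_inner_right ℂ fun v => ?_
    have h1 : ⟪adjoint V y, PiLp.single 2 i v⟫_ℂ = ⟪y, C i v⟫_ℂ := by
      rw [adjoint_inner_left, hV, Finset.sum_eq_single i]
      · simp
      · intro j _ hj
        simp [hj]
      · simp
    rw [adjoint_inner_left, ← h1, PiLp.inner_apply, Finset.sum_eq_single i]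
    · simp
    · intro j _ hj
      simp [hj]
    · simp
  have hcomm : Commute (adjoint V ∘L V) (amplification ι R) := by
    ext y i
    change adjoint V (V (amplification ι R y)) i = R (adjoint V (V y) i)
    rw [hV', hV', hV, hV, map_sum, map_sum, map_sum]
    exact Finset.sum_congr rfl fun j _ => congrArg (fun B : E →L[ℂ] E => B (y j)) (h i j).eq
  have h2 := norm_apply_comp_le_of_commute V (amplification ι R) hcomm (WithLp.toLp 2 x)
  rw [hV, hV] at h2
  exact h2.trans (mul_le_mul_of_nonneg_right (norm_amplification_le R) (norm_nonneg _))

end HilbertSpace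

/-! ### Analysis and synthesis for the projective representation -/

namespace SigmaRep

variable {Γ : Type*} [Group Γ] {σ : Cocycle Γ} {H : Type*}
  [NormedAddCommGroup H] [InnerProductSpace ℂ H] [CompleteSpace H] (π : SigmaRep σ H)

theorem op_op (x y : Γ) (f : H) : π.op x (π.op y f) = (σ.toFun x y : ℂ) • π.op (x * y) f :=
  congrArg (fun B : H →L[ℂ] H => B f) (π.map_mul x y)

theorem op_mul (x y : Γ) (f : H) :
    π.op (x * y) f = ((σ.toFun x y)⁻¹ : Circle) • π.op x (π.op y f) := by
  rw [op_op, Circle.smul_def, smul_smul, ← Circle.coe_mul, inv_mul_cancel, Circle.coe_one,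
    one_smul]

@[simp]
theorem op_one (f : H) : π.op 1 f = f := by
  simp [op, π.map_one]

theorem inner_op_op (x : Γ) (f g : H) : ⟪π.op x f, π.op x g⟫_ℂ = ⟪f, g⟫_ℂ :=
  Unitary.inner_map_map (π.toFun x) f g

theorem op_surjective (x : Γ) : Function.Surjective (π.op x) := fun f =>
  ⟨(star (π.toFun x) : unitary (H →L[ℂ] H)).1 f,
    congrArg (fun B : H →L[ℂ] H => B f) (Unitary.coe_mul_star_self (π.toFun x))⟩

/-- Vectors all of whose matrix coefficients are square-summable. -/
def IsAdmissible (g : H) : Prop := ∀ f : H, Memℓp (π.coeff g f) 2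

variable {π}

theorem IsAdmissible.of_mem_besselVectors {g : H} (hg : g ∈ π.besselVectors) :
    π.IsAdmissible g := by
  obtain ⟨B, -, hB⟩ := hg
  intro f
  refine (memℓp_gen_iff (p := 2) (by norm_num)).2 ?_
  simpa using (hB f).1

/-- The analysis operator `f ↦ (⟨f, π(γ) g⟩)_γ`; it is bounded by the closed graph theorem. -/
noncomputable def IsAdmissible.analysis {g : H} (hg : π.IsAdmissible g) :
    H →L[ℂ] lp (fun _ : Γ => ℂ) 2 :=
  ContinuousLinearMap.ofSeqClosedGraph
    (g :=
      { toFun := fun f => ⟨π.coeff g f, hg f⟩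
        map_add' := fun f f' => by
          ext γ
          exact inner_add_right _ f f'
        map_smul' := fun a f => by
          ext γ
          exact inner_smul_right _ f a })
    (fun u x y hu hy => by
      ext γ
      have h1 : Filter.Tendsto (fun n => π.coeff g (u n) γ) Filter.atTop (nhds (y γ)) :=
        ((lp.lipschitzWith_one_eval (E := fun _ : Γ => ℂ) 2 γ).continuous.tendsto y).comp hy
      have h2 : Filter.Tendsto (fun n => π.coeff g (u n) γ) Filter.atTop
          (nhds (π.coeff g x γ)) :=
        ((innerSL ℂ (π.op γ g)).continuous.tendsto x).comp hu
      exact tendsto_nhds_unique h1 h2)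

theorem IsAdmissible.analysis_apply {g : H} (hg : π.IsAdmissible g) (f : H) (γ : Γ) :
    hg.analysis f γ = ⟪π.op γ g, f⟫_ℂ := rfl

theorem IsAdmissible.mem_besselVectors {g : H} (hg : π.IsAdmissible g) :
    g ∈ π.besselVectors := by
  -- The `+ 1` only keeps the constant strictly positive.
  refine ⟨‖hg.analysis‖ ^ 2 + 1, by positivity, fun f => ⟨?_, ?_⟩⟩
  · simpa using (memℓp_gen_iff (p := 2) (by norm_num)).1 (hg f)
  · have h1 := lp.norm_rpow_eq_tsum (p := 2) (by norm_num) (hg.analysis f)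
    have h2 : ∑' γ : Γ, ‖π.coeff g f γ‖ ^ 2 = ‖hg.analysis f‖ ^ 2 := by
      simp only [ENNReal.toReal_ofNat, Real.rpow_ofNat] at h1
      exact h1.symm
    rw [h2]
    have h3 := pow_le_pow_left₀ (norm_nonneg _) (hg.analysis.le_opNorm f) 2
    nlinarith [sq_nonneg ‖f‖]

theorem IsAdmissible.op {g : H} (hg : π.IsAdmissible g) (x : Γ) :
    π.IsAdmissible (π.op x g) := by
  intro f
  refine (memℓp_gen_iff (p := 2) (by norm_num)).2 ?_
  have h := (memℓp_gen_iff (p := 2) (by norm_num)).1 (hg f)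
  have h1 := (Equiv.mulRight x).summable_iff.2 h
  refine h1.congr fun γ => congrArg (· ^ (2 : ENNReal).toReal) ?_
  change ‖⟪π.op (γ * x) g, f⟫_ℂ‖ = ‖⟪π.op γ (π.op x g), f⟫_ℂ‖
  rw [op_op, inner_smul_left, norm_mul, RCLike.norm_conj, Circle.norm_coe, one_mul]

open ContinuousLinearMap in
/-- The adjoint of the analysis operator is the synthesis operator. -/
theorem IsAdmissible.hasSum_synthesis {g : H} (hg : π.IsAdmissible g)
    (c : lp (fun _ : Γ => ℂ) 2) :
    HasSum (fun γ => c γ • π.op γ g) (adjoint hg.analysis c) := by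
  classical
  have h1 := (lp.hasSum_single (p := 2) (by norm_num) c).mapL (adjoint hg.analysis)
  convert h1 using 2 with γ
  refine ext_inner_right ℂ fun f => ?_
  rw [adjoint_inner_left, lp.inner_single_left, inner_smul_left, hg.analysis_apply]
  simp [mul_comm]

/-- The twist undoing π(x) is the same isometry for every `g`, so it cancels in inner products of
two different analysis operators. -/
theorem IsAdmissible.lpTwist_analysis_op {g : H} (hg : π.IsAdmissible g) (x : Γ) (f : H) :
    lpTwist (Equiv.mulLeft x) (fun η => (σ.toFun x η)⁻¹) (hg.analysis (π.op x f))
      = hg.analysis f := by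
  ext η
  rw [lpTwist_apply, hg.analysis_apply, hg.analysis_apply, Equiv.coe_mulLeft, op_mul,
    Circle.smul_def, inner_smul_left, inner_op_op, ← mul_assoc, ← Circle.coe_inv_eq_conj,
    ← Circle.coe_mul]
  simp

open ContinuousLinearMap in
theorem IsAdmissible.adjoint_comp_mem_centralizer {f g : H} (hf : π.IsAdmissible f)
    (hg : π.IsAdmissible g) :
    adjoint hf.analysis ∘L hg.analysis ∈ Set.centralizer (Set.range π.op) := by
  rintro _ ⟨x, rfl⟩
  ext k
  refine ext_inner_left ℂ fun h => ?_
  obtain ⟨h, rfl⟩ := π.op_surjective x h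
  change ⟪π.op x h, π.op x (adjoint hf.analysis (hg.analysis k))⟫_ℂ
    = ⟪π.op x h, adjoint hf.analysis (hg.analysis (π.op x k))⟫_ℂ
  rw [inner_op_op, adjoint_inner_right, adjoint_inner_right, ← hf.lpTwist_analysis_op x h,
    ← hg.lpTwist_analysis_op x k, LinearIsometry.inner_map_map]

open ContinuousLinearMap in
theorem exists_synthesis_eq {T : H →L[ℂ] H} (hT : T ∈ π.vonNeumann) :
    ∃ c : lp (fun _ : Γ => ℂ) 2, ∀ f, ∀ hf : π.IsAdmissible f,
      adjoint hf.analysis c = T f := by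
  classical
  have hcomm : ∀ f g : {f // π.IsAdmissible f},
      Commute (adjoint f.2.analysis ∘L g.2.analysis) (adjoint T) := fun f g => by
    have h1 : Commute (adjoint g.2.analysis ∘L f.2.analysis) T :=
      hT _ (g.2.adjoint_comp_mem_centralizer f.2)
    have h2 := h1.star_star
    rwa [star_eq_adjoint, star_eq_adjoint, adjoint_comp, adjoint_adjoint] at h2
  let A (R : H →L[ℂ] H) : ({f // π.IsAdmissible f} →₀ H) →ₗ[ℂ] lp (fun _ : Γ => ℂ) 2 :=
    Finsupp.lsum ℂ fun f => (f.2.analysis ∘L R).toLinearMap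
  have hbound : ∀ m, ‖A (adjoint T) m‖ ≤ ‖adjoint T‖ * ‖A 1 m‖ := fun m => by
    have h1 := norm_sum_apply_comp_le_of_commute (ι := m.support)
      (fun f => f.1.2.analysis) (adjoint T) (fun f g => hcomm f.1 g.1) (fun f => m f.1)
    rw [Finset.sum_coe_sort m.support fun f => f.2.analysis (adjoint T (m f)),
      Finset.sum_coe_sort m.support fun f => f.2.analysis (m f)] at h1
    exact h1
  -- Evaluation at the identity, where C_f (T*h) takes the value ⟨f, T*h⟩.
  let φ : ({f // π.IsAdmissible f} →₀ H) →ₗ[ℂ] ℂ :=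
    (innerSL ℂ (lp.single (E := fun _ : Γ => ℂ) 2 (1 : Γ) (1 : ℂ))).toLinearMap ∘ₗ A (adjoint T)
  have hφ : ∀ m, ‖φ m‖ ≤ ‖adjoint T‖ * ‖A 1 m‖ := fun m => by
    refine le_trans ?_ (hbound m)
    refine (norm_inner_le_norm (𝕜 := ℂ)
      (lp.single (E := fun _ : Γ => ℂ) 2 (1 : Γ) (1 : ℂ)) _).trans ?_
    rw [lp.norm_single (by norm_num), norm_one, one_mul]
  obtain ⟨c, hc⟩ := exists_inner_eq_of_norm_le (A 1) φ _ hφ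
  refine ⟨c, fun f hf => ext_inner_right ℂ fun h => ?_⟩
  have h1 := hc (Finsupp.single ⟨f, hf⟩ h)
  have h2 : A 1 (Finsupp.single ⟨f, hf⟩ h) = hf.analysis h := by simp [A]
  have h3 : A (adjoint T) (Finsupp.single ⟨f, hf⟩ h) = hf.analysis (adjoint T h) := by simp [A]
  have h4 : φ (Finsupp.single ⟨f, hf⟩ h) = ⟪f, adjoint T h⟫_ℂ := by
    change ⟪lp.single (E := fun _ : Γ => ℂ) 2 (1 : Γ) (1 : ℂ), A (adjoint T) (Finsupp.single ⟨f, hf⟩ h)⟫_ℂ = _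
    rw [h3, lp.inner_single_left, hf.analysis_apply, op_one]
    simp
  rw [adjoint_inner_left, ← h2, h1, h4, adjoint_inner_right]

variable (π) in
open ContinuousLinearMap in
/-- The square-summable sequences annihilated by all synthesis operators. -/
noncomputable def synthesisKer : Submodule ℂ (lp (fun _ : Γ => ℂ) 2) :=
  ⨅ f : {f // π.IsAdmissible f}, LinearMap.ker (adjoint f.2.analysis).toLinearMap

open ContinuousLinearMap in
theorem mem_synthesisKer_iff {c : lp (fun _ : Γ => ℂ) 2} :
    c ∈ π.synthesisKer ↔
      ∀ f, π.IsAdmissible f → HasSum (fun γ => c γ • π.op γ f) 0 := by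
  simp only [synthesisKer, Submodule.mem_iInf, LinearMap.mem_ker, Subtype.forall]
  refine forall₂_congr fun f hf => ⟨fun h => ?_, fun h => ?_⟩
  · have h1 := hf.hasSum_synthesis c
    rwa [show adjoint hf.analysis c = 0 from h] at h1
  · exact (hf.hasSum_synthesis c).unique h

open ContinuousLinearMap in
theorem isClosed_synthesisKer : IsClosed (π.synthesisKer : Set (lp (fun _ : Γ => ℂ) 2)) := by
  rw [synthesisKer, Submodule.coe_iInf]
  exact isClosed_iInter fun f => (adjoint f.2.analysis).isClosed_ker

theorem hasSum_zero_of_hasSum_op {u : Γ → H} (x : Γ) (h : HasSum (fun γ => π.op x (u γ)) 0) :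
    HasSum u 0 := by
  have h1 := h.mapL (star (π.toFun x) : unitary (H →L[ℂ] H)).1
  have h2 : ∀ k, (star (π.toFun x) : unitary (H →L[ℂ] H)).1 (π.op x k) = k := fun k =>
    congrArg (fun B : H →L[ℂ] H => B k) (Unitary.coe_star_mul_self (π.toFun x))
  simpa only [h2, map_zero] using h1

theorem lpTwist_mulLeft_mem_synthesisKer {c : lp (fun _ : Γ => ℂ) 2}
    (hc : c ∈ π.synthesisKer) (x : Γ) :
    lpTwist (Equiv.mulLeft x) (fun η => (σ.toFun x η)⁻¹) c ∈ π.synthesisKer := by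
  rw [mem_synthesisKer_iff] at hc ⊢
  intro f hf
  refine hasSum_zero_of_hasSum_op (π := π) x ?_
  have h := (Equiv.mulLeft x).hasSum_iff.2 (hc f hf)
  convert h using 2 with η
  simp only [Function.comp_apply, lpTwist_apply, map_smul, Equiv.coe_mulLeft, op_mul,
    Circle.smul_def, smul_smul]
  rw [mul_comm]

/-- Membership is tested on π(x)f, which is again admissible; moving π(x) to the left turns γ into a
conjugate and produces the cocycle weight. -/
theorem lpTwist_conj_mem_synthesisKer {c : lp (fun _ : Γ => ℂ) 2}
    (hc : c ∈ π.synthesisKer) (x : Γ) :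
    lpTwist (MulAut.conj x).toEquiv
      (fun η => σ.toFun (x * η * x⁻¹) x * (σ.toFun x η)⁻¹) c ∈ π.synthesisKer := by
  rw [mem_synthesisKer_iff] at hc ⊢
  intro f hf
  refine hasSum_zero_of_hasSum_op (π := π) x ?_
  have h := (MulAut.conj x).toEquiv.hasSum_iff.2 (hc _ (hf.op x))
  convert h using 2 with η
  have h1 : π.op (x * η * x⁻¹) (π.op x f)
      = (σ.toFun (x * η * x⁻¹) x * (σ.toFun x η)⁻¹ : Circle) • π.op x (π.op η f) := by
    rw [op_op, inv_mul_cancel_right, op_mul, mul_smul, Circle.smul_def (σ.toFun _ x)]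
  simp only [Function.comp_apply, lpTwist_apply, map_smul]
  change _ = c (x * η * x⁻¹) • π.op (x * η * x⁻¹) (π.op x f)
  rw [h1, Circle.smul_def, smul_smul, mul_comm]
  rfl

theorem synthesisKer_eq_bot (hσ : σ.Kleppner) {g : H} (hg : π.IsAdmissible g) (hg0 : g ≠ 0) :
    π.synthesisKer = ⊥ := by
  classical
  have : CompleteSpace π.synthesisKer := isClosed_synthesisKer.completeSpace_coe
  set δ : lp (fun _ : Γ => ℂ) 2 := lp.single 2 (1 : Γ) (1 : ℂ) with hδ
  set p := π.synthesisKer.starProjection δ with hp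
  have hpN : p ∈ π.synthesisKer := π.synthesisKer.starProjection_apply_mem δ
  have hfix : ∀ x η : Γ,
      ((σ.toFun (x * η * x⁻¹) x * (σ.toFun x η)⁻¹ : Circle) : ℂ) * p (x * η * x⁻¹) = p η := by
    intro x η
    have h := starProjection_eq_of_isometry π.synthesisKer _
      (fun c hc => lpTwist_conj_mem_synthesisKer hc x) (d := δ) (by
        ext η
        by_cases h : η = 1
        · subst h
          simp [σ.left_one, σ.right_one]
        · have h' : x * η * x⁻¹ ≠ 1 := by simpa [conj_eq_one_iff] using h
          simp [hδ, lp.single_apply, h, h'])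
    exact congrArg (fun c : lp (fun _ : Γ => ℂ) 2 => c η) h
  have hsupp : ∀ η, η ≠ 1 → p η = 0 := by
    intro η hη
    by_contra hp0
    refine hσ η hη (fun x hx => ?_) ?_
    -- For `x` commuting with `η`, invariance of `p η ≠ 0` forces the weight to be 1, which is
    -- σ-regularity of `η`.
    · have h := hfix x η
      rw [hx, mul_inv_cancel_right] at h
      have h1 := mul_right_cancel₀ hp0 (h.trans (one_mul _).symm)
      exact mul_inv_eq_one.1 (Circle.coe_eq_one.1 h1)
    -- |p| is constant on the conjugacy class, so square-summability makes the class finite.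
    · refine (lp_two_finite_norm_ge p (norm_pos_iff.2 hp0)).subset ?_
      rintro _ ⟨x, rfl⟩
      have h := congrArg norm (hfix x η)
      rw [norm_mul, Circle.norm_coe, one_mul] at h
      exact h.ge
  have hp1 : p 1 = 0 := by
    have h1 := mem_synthesisKer_iff.1 hpN g hg
    have h2 := h1.unique (hasSum_single 1 fun η hη => by rw [hsupp η hη, zero_smul])
    rw [op_one] at h2
    exact (smul_eq_zero.1 h2.symm).resolve_right hg0
  have hp0 : p = 0 := by
    ext η
    by_cases h : η = 1
    · rw [h, hp1]; rfl
    · rw [hsupp η h]; rfl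
  have hone : ∀ c ∈ π.synthesisKer, c 1 = 0 := fun c hc => by
    have h := π.synthesisKer.starProjection_inner_eq_zero δ c hc
    rw [← hp, hp0, sub_zero, hδ, lp.inner_single_left] at h
    simpa using h
  refine (Submodule.eq_bot_iff _).2 fun c hc => ?_
  ext x
  -- The translate of `c` has value `c x` at the identity.
  have h := hone _ (lpTwist_mulLeft_mem_synthesisKer hc x)
  simpa [σ.right_one] using h

end SigmaRep

theorem mainTheorem3 {Γ : Type*} [Group Γ] [Countable Γ]
    {H : Type*} [NormedAddCommGroup H] [InnerProductSpace ℂ H] [CompleteSpace H]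
    [TopologicalSpace.SeparableSpace H] [Nontrivial H]
    (σ : Cocycle Γ) (hσ : σ.Kleppner)
    (π : SigmaRep σ H) (hπ : π.IsSquareIntegrable)
    (T : H →L[ℂ] H) (hT : T ∈ π.vonNeumann) :
    ∃! c : lp (fun _ : Γ => ℂ) 2,
      ∀ f ∈ π.besselVectors, HasSum (fun γ : Γ => c γ • π.op γ f) (T f) := by
  obtain ⟨D, hD, hDm⟩ := hπ
  obtain ⟨g, hgD, hg0⟩ : ∃ g ∈ D, g ≠ 0 := hD.exists_mem_open isOpen_ne (exists_ne (0 : H))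
  have hker := SigmaRep.synthesisKer_eq_bot hσ (π := π) (fun f => hDm f g hgD) hg0
  obtain ⟨c, hc⟩ := SigmaRep.exists_synthesis_eq hT
  have hcT : ∀ f ∈ π.besselVectors, HasSum (fun γ : Γ => c γ • π.op γ f) (T f) :=
    fun f hf => by
      have hf' := SigmaRep.IsAdmissible.of_mem_besselVectors hf
      exact hc f hf' ▸ hf'.hasSum_synthesis c
  refine ⟨c, hcT, fun c' hc' => sub_eq_zero.1 ?_⟩
  rw [← Submodule.mem_bot ℂ, ← hker, SigmaRep.mem_synthesisKer_iff]
  intro f hf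
  have h := (hc' f hf.mem_besselVectors).sub (hcT f hf.mem_besselVectors)
  simpa only [sub_self, ← sub_smul, lp.coeFn_sub, Pi.sub_apply] using h
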